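/- Let $G$ be a topological group. A $G$-flow is a nonempty compact Hausdorff space with a jointly continuous action of $G$; a $G$-map is a continuous equivariant map between $G$-flows, an extension is a surjective $G$-map, and a subflow is a nonempty closed $G$-invariant subset. An extension $\phi\colon Y\to W$ is $G$-irreducible if $\phi(C)\neq W$ for every proper subflow $C\subsetneq Y$. A $G$-projective cover of a $G$-flow $W$ is a $G$-irreducible extension $p\colon X\to W$ such that for every $G$-irreducible extension $\pi\colon Z\to W$ there is a $G$-map $\psi\colon X\to Z$ with $\pi\circ\psi=p$. An affine $G$-flow is a nonempty compact convex subset $K$ of a Hausdorff locally convex real topological vector space, with a jointly continuous action of $G$ on $K$ by affine homeomorphisms. Affine $G$-maps are continuous affine equivariant maps, affine extensions are surjective affine $G$-maps, and affine subflows are nonempty compact convex $G$-invariant subsets. An affine extension $\phi\colon K\to L$ is affine $G$-irreducible if $\phi(C)\ne L$ for every proper affine subflow $C\subsetneq K$. An affine $G$-flow $K$ is affine $G$-projective if for every affine $G$-map $\phi\colon K\to L$ and every affine extension $\pi\colon P\to L$ there is an affine $G$-map $\psi\colon K\to P$ with $\pi\circ\psi=\phi$. An affine $G$-projective cover of $K$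 is a pair $(L,\psi)$ where $L$ is an affine $G$-projective affine $G$-flow and $\psi\colon L\to K$ is an affine $G$-irreducible extension. For a $G$-flow $X$, $P(X)$ denotes the affine $G$-flow of regular Borel probability measures on $X$, viewed in $C(X)^*$ with the weak-$*$ topology and with $G$ acting by push-forward; $\delta_x$ is the Dirac mass at $x$. **Theorem.** Let $K$ be an affine $G$-flow, let $\overline{\operatorname{ext}}(K)$ be the closure of its set of extreme points (a $G$-flow), and let $p\colon X\to\overline{\operatorname{ext}}(K)$ be a $G$-projective cover of it. Then there is an affine extension $\phi\colon P(X)\to K$ with $\phi(\delta_x)=p(x)$ for all $x\in X$, such that there exists an affine subflow $L\subseteq P(X)$ minimal (under inclusion) among the affine subflows $C$ of $P(X)$ with $\phi(C)=K$, and for every such minimal $L$: 1. $(L,\phi|_L)$ is an affine $G$-projective cover of $K$; 2. it is the affine $G$-projective cover of $K$ up to isomorphism: for every affine $G$-projective cover $(M,\psi)$ of $K$ there is a bijective affine $G$-map $e\colon L\to M$ with $\psi\circ e=\phi|_L$. -/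

import Mathlib

open MeasureTheory Set

universe u

/-! ### Flows -/

/-- A `G`-flow: a nonempty compact Hausdorff space with a (jointly) continuous action of `G`. -/
structure GFlow (G : Type u) [Group G] [TopologicalSpace G] : Type (u + 1) where
  carrier : Type u
  [top : TopologicalSpace carrier]
  [compact : CompactSpace carrier]
  [t2 : T2Space carrier]
  [nonempty : Nonempty carrier]
  [action : MulAction G carrier]
  [continuous_action : ContinuousSMul G carrier]

namespace GFlow

instance (G : Type u) [Group G] [TopologicalSpace G] : CoeSort (GFlow G) (Type u) :=
  ⟨GFlow.carrier⟩

attribute [instance] GFlow.top GFlow.compact GFlow.t2 GFlow.nonempty GFlow.action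
  GFlow.continuous_action

variable {G : Type u} [Group G] [TopologicalSpace G]

/-- `G`-maps: continuous equivariant maps. -/
def IsGMap {X Y : GFlow G} (φ : X → Y) : Prop :=
  Continuous φ ∧ ∀ (g : G) (x : X), φ (g • x) = g • φ x

/-- Extensions: surjective `G`-maps. -/
def IsExtension {X Y : GFlow G} (φ : X → Y) : Prop :=
  IsGMap φ ∧ Function.Surjective φ

/-- Subflows: nonempty closed invariant subsets. -/
def IsSubflow (X : GFlow G) (C : Set X) : Prop :=
  C.Nonempty ∧ IsClosed C ∧ ∀ (g : G), ∀ x ∈ C, g • x ∈ C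

/-- `G`-irreducible extensions: no proper subflow is mapped onto the whole codomain. -/
def IsGIrreducible {X Y : GFlow G} (φ : X → Y) : Prop :=
  IsExtension φ ∧ ∀ C : Set X, X.IsSubflow C → C ≠ univ → φ '' C ≠ univ

/-- `(Y, φ)` is a `G`-projective cover of `X`: `φ : Y → X` is a `G`-irreducible extension which
factors through every `G`-irreducible extension of `X`. -/
def IsGProjectiveCover {Y X : GFlow G} (φ : Y → X) : Prop :=
  IsGIrreducible φ ∧
    ∀ (Z : GFlow G) (π : Z → X), IsGIrreducible π → ∃ ψ : Y → Z, IsGMap ψ ∧ π ∘ ψ = φ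

/-- A subflow, regarded as a flow. -/
def restrict (X : GFlow G) (C : Set X) (hC : X.IsSubflow C) : GFlow G :=
  letI : MulAction G C :=
    { smul := fun g x => ⟨g • (x : X), hC.2.2 g x x.2⟩
      one_smul := fun x => Subtype.ext (one_smul G (x : X))
      mul_smul := fun g h x => Subtype.ext (mul_smul g h (x : X)) }
  { carrier := C
    compact := isCompact_iff_compactSpace.mp hC.2.1.isCompact
    nonempty := hC.1.to_subtype
    continuous_action := ⟨Continuous.subtype_mk
      (continuous_fst.smul (continuous_subtype_val.comp continuous_snd)) _⟩ }

end GFlow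

/-! ### Affine flows -/

/-- An affine `G`-flow: a nonempty compact convex subset `carrier` of a Hausdorff locally convex
real topological vector space `E`, with a (jointly) continuous action of `G` on `carrier` by affine
maps (which are then affine homeomorphisms). -/
structure AffineFlow (G : Type u) [Group G] [TopologicalSpace G] : Type (u + 1) where
  E : Type u
  [addCommGroup : AddCommGroup E]
  [module : Module ℝ E]
  [top : TopologicalSpace E]
  [topAddGroup : IsTopologicalAddGroup E]
  [continuousSMul : ContinuousSMul ℝ E]
  [locallyConvex : LocallyConvexSpace ℝ E]
  [t2 : T2Space E]
  carrier : Set E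
  nonempty : carrier.Nonempty
  compact : IsCompact carrier
  convex : Convex ℝ carrier
  [action : MulAction G carrier]
  [continuous_action : ContinuousSMul G carrier]
  affine_action : ∀ (g : G) (x y z : carrier) (a b : ℝ), 0 ≤ a → 0 ≤ b → a + b = 1 →
    (z : E) = a • (x : E) + b • (y : E) →
    ((g • z : carrier) : E) = a • ((g • x : carrier) : E) + b • ((g • y : carrier) : E)

namespace AffineFlow

attribute [instance] AffineFlow.addCommGroup AffineFlow.module AffineFlow.top
  AffineFlow.topAddGroup AffineFlow.continuousSMul AffineFlow.locallyConvex AffineFlow.t2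
  AffineFlow.action AffineFlow.continuous_action

instance (G : Type u) [Group G] [TopologicalSpace G] : CoeSort (AffineFlow G) (Type u) :=
  ⟨fun K => K.carrier⟩

variable {G : Type u} [Group G] [TopologicalSpace G]

/-- The `G`-flow underlying an affine `G`-flow. -/
def toGFlow (K : AffineFlow G) : GFlow G where
  carrier := K.carrier
  compact := isCompact_iff_compactSpace.mp K.compact
  nonempty := K.nonempty.to_subtype

/-- Affine `G`-maps: continuous equivariant maps which preserve convex combinations. -/
def IsAffineGMap {K L : AffineFlow G} (φ : K → L) : Prop :=
  Continuous φ ∧ (∀ (g : G) (x : K), φ (g • x) = g • φ x) ∧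
    ∀ (x y z : K) (a b : ℝ), 0 ≤ a → 0 ≤ b → a + b = 1 →
      (z : K.E) = a • (x : K.E) + b • (y : K.E) →
      (φ z : L.E) = a • (φ x : L.E) + b • (φ y : L.E)

/-- Affine extensions: surjective affine `G`-maps. -/
def IsAffineExtension {K L : AffineFlow G} (φ : K → L) : Prop :=
  IsAffineGMap φ ∧ Function.Surjective φ

/-- Affine subflows: nonempty closed (equivalently, compact) convex invariant subsets. -/
def IsAffineSubflow (K : AffineFlow G) (C : Set K) : Prop :=
  C.Nonempty ∧ IsClosed C ∧ Convex ℝ (Subtype.val '' C : Set K.E) ∧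
    ∀ (g : G), ∀ x ∈ C, g • x ∈ C

/-- Affine `G`-irreducible extensions: no proper affine subflow is mapped onto the whole
codomain. -/
def IsAffineGIrreducible {K L : AffineFlow G} (φ : K → L) : Prop :=
  IsAffineExtension φ ∧ ∀ C : Set K, K.IsAffineSubflow C → C ≠ univ → φ '' C ≠ univ

/-- Affine `G`-projective flows: affine `G`-maps out of `K` lift along affine extensions. -/
def IsAffineGProjective (K : AffineFlow G) : Prop :=
  ∀ (L P : AffineFlow G) (φ : K → L) (π : P → L), IsAffineGMap φ → IsAffineExtension π →
    ∃ ψ : K → P, IsAffineGMap ψ ∧ π ∘ ψ = φ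

/-- `(L, ψ)` is an affine `G`-projective cover of `K`. -/
def IsAffineGProjectiveCover {L K : AffineFlow G} (ψ : L → K) : Prop :=
  L.IsAffineGProjective ∧ IsAffineGIrreducible ψ

/-- The inclusion of a subset of `K.carrier`, viewed in the ambient space, into `K`. -/
def ofImage (K : AffineFlow G) (C : Set K) (x : (Subtype.val '' C : Set K.E)) : K :=
  ⟨x, by obtain ⟨y, -, hy⟩ := x.2; exact hy ▸ y.2⟩

theorem ofImage_mem (K : AffineFlow G) (C : Set K) (x : (Subtype.val '' C : Set K.E)) :
    K.ofImage C x ∈ C := by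
  obtain ⟨_, y, hy, rfl⟩ := x
  exact hy

/-- The action of `G` on an affine subflow. -/
@[reducible] def restrictAction (K : AffineFlow G) (C : Set K) (hC : K.IsAffineSubflow C) :
    MulAction G (Subtype.val '' C : Set K.E) where
  smul g x := ⟨(g • K.ofImage C x : K), _, hC.2.2.2 g _ (K.ofImage_mem C x), rfl⟩
  one_smul x := by
    apply Subtype.ext
    have h := congrArg (fun y : K => (y : K.E)) (one_smul G (K.ofImage C x))
    exact h
  mul_smul g h x := by
    apply Subtype.ext
    have h' := congrArg (fun y : K => (y : K.E)) (mul_smul g h (K.ofImage C x))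
    exact h'

/-- An affine subflow, regarded as an affine flow in the same ambient space. -/
def restrict (K : AffineFlow G) (C : Set K) (hC : K.IsAffineSubflow C) : AffineFlow G where
  E := K.E
  carrier := Subtype.val '' C
  nonempty := hC.1.image _
  compact := by
    have := isCompact_iff_compactSpace.mp K.compact
    exact hC.2.1.isCompact.image continuous_subtype_val
  convex := hC.2.2.1
  action := K.restrictAction C hC
  continuous_action := by
    let _ := K.restrictAction C hC
    have h1 : Continuous (K.ofImage C) := Continuous.subtype_mk continuous_subtype_val _
    have h2 : Continuous fun p : G × (Subtype.val '' C : Set K.E) => p.1 • K.ofImage C p.2 :=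
      continuous_fst.smul (h1.comp continuous_snd)
    exact ⟨Continuous.subtype_mk (continuous_subtype_val.comp h2) _⟩
  affine_action := fun g x y z a b ha hb hab h =>
    K.affine_action g (K.ofImage C x) (K.ofImage C y) (K.ofImage C z) a b ha hb hab h

/-- The inclusion of an affine subflow. -/
def incl (K : AffineFlow G) (C : Set K) (hC : K.IsAffineSubflow C) (x : K.restrict C hC) : K :=
  K.ofImage C ⟨x.1, x.2⟩

/-! ### The closure of the set of extreme points -/

/-- The set `ext(K)` of extreme points of `K`. -/
def extPts (K : AffineFlow G) : Set K :=
  {x | (x : K.E) ∈ K.carrier.extremePoints ℝ}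

theorem smul_mem_extPts (K : AffineFlow G) (g : G) {x : K} (hx : x ∈ K.extPts) : g • x ∈ K.extPts := by
  refine mem_extremePoints.mpr ⟨(g • x).2, ?_⟩
  rintro y hy z hz ⟨a, b, ha, hb, hab, h⟩
  have key := K.affine_action g⁻¹ ⟨y, hy⟩ ⟨z, hz⟩ (g • x) a b ha.le hb.le hab h.symm
  rw [inv_smul_smul] at key
  have h2 := (mem_extremePoints.mp hx).2 _ (g⁻¹ • (⟨y, hy⟩ : K)).2 _ (g⁻¹ • (⟨z, hz⟩ : K)).2
    ⟨a, b, ha, hb, hab, key.symm⟩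
  have h3 : g⁻¹ • (⟨y, hy⟩ : K) = x := Subtype.ext h2.1
  have h4 : g⁻¹ • (⟨z, hz⟩ : K) = x := Subtype.ext h2.2
  exact ⟨congrArg Subtype.val (inv_smul_eq_iff.mp h3), congrArg Subtype.val (inv_smul_eq_iff.mp h4)⟩

theorem isSubflow_closure_extPts (K : AffineFlow G) : K.toGFlow.IsSubflow (closure K.extPts) := by
  refine ⟨?_, isClosed_closure, fun g x hx => ?_⟩
  · obtain ⟨x, hx⟩ := K.compact.extremePoints_nonempty K.nonempty
    exact ⟨⟨x, hx.1⟩, subset_closure hx⟩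
  · exact map_mem_closure (continuous_const_smul (T := K.toGFlow) g) hx
      fun y hy => K.smul_mem_extPts g hy

/-- The `G`-flow given by the closure of the set of extreme points of `K`. -/
def extClosure (K : AffineFlow G) : GFlow G :=
  K.toGFlow.restrict (closure K.extPts) K.isSubflow_closure_extPts

/-- The inclusion of the closure of `ext(K)` into `K`. -/
def extIncl (K : AffineFlow G) (x : K.extClosure) : K :=
  Subtype.val (p := fun y : K => y ∈ closure K.extPts) x

end AffineFlow

/-! ### The affine flow of regular Borel probability measures -/

/-- `P(X)` inside the weak-* dual of `C(X)`: the functionals of the form `f ↦ ∫ f dμ`, where `μ`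
is a regular Borel probability measure on `X`. -/
def probMeasures (X : Type u) [TopologicalSpace X] [CompactSpace X] :
    Set (WeakDual ℝ C(X, ℝ)) :=
  letI : MeasurableSpace X := borel X
  {Λ | ∃ μ : Measure X, IsProbabilityMeasure μ ∧ μ.Regular ∧ ∀ f : C(X, ℝ), Λ f = ∫ x, f x ∂μ}

section ProbMeasures

variable {X : Type u} [TopologicalSpace X] [CompactSpace X]

theorem mem_probMeasures_iff [T2Space X] (Λ : WeakDual ℝ C(X, ℝ)) :
    Λ ∈ probMeasures X ↔ (∀ f : C(X, ℝ), 0 ≤ f → 0 ≤ Λ f) ∧ Λ 1 = 1 := by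
  let _ : MeasurableSpace X := borel X
  have : BorelSpace X := ⟨rfl⟩
  constructor
  · rintro ⟨μ, hμ, -, h⟩
    refine ⟨fun f hf => ?_, ?_⟩
    · rw [h]
      exact integral_nonneg fun x => hf x
    · rw [h]
      simp
  · rintro ⟨hpos, h1⟩
    let Λ' : CompactlySupportedContinuousMap X ℝ →ₚ[ℝ] ℝ :=
      PositiveLinearMap.mk₀
        { toFun := fun f => Λ (f : C(X, ℝ))
          map_add' := fun f g => map_add Λ (f : C(X, ℝ)) (g : C(X, ℝ))
          map_smul' := fun c f => map_smul Λ c (f : C(X, ℝ)) }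
        (fun f hf => hpos f hf)
    have key : ∀ f : C(X, ℝ), Λ f = ∫ x, f x ∂(RealRMK.rieszMeasure Λ') := fun f =>
      (RealRMK.integral_rieszMeasure Λ'
        (CompactlySupportedContinuousMap.continuousMapEquiv f)).symm
    refine ⟨RealRMK.rieszMeasure Λ', ⟨?_⟩, inferInstance, key⟩
    have h := key 1
    rw [h1] at h
    simp only [ContinuousMap.one_apply, integral_const, smul_eq_mul, mul_one] at h
    rw [measureReal_def] at h
    rw [← ENNReal.toReal_eq_one_iff, ← h]

theorem norm_apply_le_of_mem_probMeasures [T2Space X] {Λ : WeakDual ℝ C(X, ℝ)}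
    (hΛ : Λ ∈ probMeasures X) (f : C(X, ℝ)) : ‖Λ f‖ ≤ ‖f‖ := by
  rw [mem_probMeasures_iff] at hΛ
  have hle : ∀ f : C(X, ℝ), Λ f ≤ ‖f‖ := fun f => by
    have h := hΛ.1 (‖f‖ • 1 - f) (fun x => by
      simpa using (le_abs_self (f x)).trans (f.norm_coe_le_norm x))
    rw [map_sub, map_smul, hΛ.2, smul_eq_mul, mul_one] at h
    linarith
  rw [Real.norm_eq_abs, abs_le]
  have h1 := hle f
  have h2 := hle (-f)
  rw [map_neg, norm_neg] at h2
  exact ⟨by linarith, h1⟩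

theorem isCompact_probMeasures [T2Space X] : IsCompact (probMeasures X) := by
  have hset : probMeasures X = {Λ : WeakDual ℝ C(X, ℝ) | (∀ f : C(X, ℝ), 0 ≤ f → 0 ≤ Λ f) ∧
      Λ 1 = 1} := ext fun Λ => mem_probMeasures_iff Λ
  refine (WeakDual.isCompact_closedBall (0 : StrongDual ℝ C(X, ℝ)) 1).of_isClosed_subset ?_ ?_
  · rw [hset]
    simp only [ofPred_and, ofPred_forall]
    refine IsClosed.inter (isClosed_iInter fun f => isClosed_iInter fun _ => ?_) ?_
    · exact isClosed_le continuous_const (WeakDual.eval_continuous f)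
    · exact isClosed_eq (WeakDual.eval_continuous 1) continuous_const
  · intro Λ hΛ
    simp only [mem_preimage, Metric.mem_closedBall, dist_zero_right]
    refine ContinuousLinearMap.opNorm_le_bound _ zero_le_one fun f => ?_
    rw [one_mul]
    exact norm_apply_le_of_mem_probMeasures hΛ f

theorem convex_probMeasures [T2Space X] : Convex ℝ (probMeasures X) := by
  intro Λ hΛ Λ' hΛ' a b ha hb hab
  rw [mem_probMeasures_iff] at *
  refine ⟨fun f hf => ?_, ?_⟩
  · exact add_nonneg (mul_nonneg ha (hΛ.1 f hf)) (mul_nonneg hb (hΛ'.1 f hf))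
  · change a * Λ 1 + b * Λ' 1 = 1
    rw [hΛ.2, hΛ'.2, mul_one, mul_one, hab]

/-- The Dirac mass at `x`, i.e. the functional `f ↦ f x`. -/
noncomputable def diracFunctional (x : X) : WeakDual ℝ C(X, ℝ) :=
  StrongDual.toWeakDual (ContinuousMap.evalCLM ℝ x)

theorem diracFunctional_mem [T2Space X] (x : X) : diracFunctional x ∈ probMeasures X := by
  rw [mem_probMeasures_iff]
  exact ⟨fun f hf => hf x, rfl⟩

/-- Push-forward of functionals along `h : X → Y`, namely `f ↦ Λ (f ∘ h)`. On integration
functionals this is the push-forward of measures, as `∫ f d(h_* μ) = ∫ f ∘ h dμ`. -/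
noncomputable def pushFunctional {Y : Type u} [TopologicalSpace Y] [CompactSpace Y] (h : C(X, Y))
    (Λ : WeakDual ℝ C(X, ℝ)) : WeakDual ℝ C(Y, ℝ) :=
  StrongDual.toWeakDual ((WeakDual.toStrongDual Λ).comp (h.compCLM ℝ ℝ))

theorem pushFunctional_mem [T2Space X] {Y : Type u} [TopologicalSpace Y] [CompactSpace Y]
    [T2Space Y] (h : C(X, Y)) {Λ : WeakDual ℝ C(X, ℝ)} (hΛ : Λ ∈ probMeasures X) :
    pushFunctional h Λ ∈ probMeasures Y := by
  rw [mem_probMeasures_iff] at *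
  exact ⟨fun f hf => hΛ.1 (f.comp h) fun x => hf (h x), hΛ.2⟩

end ProbMeasures

namespace GFlow

variable {G : Type u} [Group G] [TopologicalSpace G]

/-- Translation by `g`, as a continuous map. -/
def translate (X : GFlow G) (g : G) : C(X, X) :=
  ⟨fun x => g • x, continuous_const_smul g⟩

/-- The action of `G` on `P(X)` by push-forward: `(g • Λ) f = Λ (x ↦ f (g • x))`. -/
@[reducible] noncomputable def probAction (X : GFlow G) : MulAction G (probMeasures X) where
  smul g Λ := ⟨pushFunctional (X.translate g) Λ, pushFunctional_mem _ Λ.2⟩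
  one_smul Λ := by
    apply Subtype.ext
    refine DFunLike.ext _ _ fun f => congrArg (Λ : WeakDual ℝ C(X, ℝ)) ?_
    ext x
    exact congrArg f (one_smul G x)
  mul_smul g h Λ := by
    apply Subtype.ext
    refine DFunLike.ext _ _ fun f => congrArg (Λ : WeakDual ℝ C(X, ℝ)) ?_
    ext x
    exact congrArg f (mul_smul g h x)

/-- The affine `G`-flow `P(X)` of regular Borel probability measures on `X`. -/
noncomputable def prob (X : GFlow G) : AffineFlow G where
  E := WeakDual ℝ C(X, ℝ)
  locallyConvex := inferInstanceAs
    (LocallyConvexSpace ℝ (WeakBilin (topDualPairing ℝ C(X, ℝ))))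
  carrier := probMeasures X
  nonempty := ⟨_, diracFunctional_mem (Classical.arbitrary X)⟩
  compact := isCompact_probMeasures
  convex := convex_probMeasures
  action := X.probAction
  continuous_action := by
    let _ := X.probAction
    refine ⟨Continuous.subtype_mk (WeakDual.continuous_of_continuous_eval fun f => ?_) _⟩
    let F : C(G, C(X, ℝ)) :=
      ContinuousMap.curry ⟨fun p : G × X => f (p.1 • p.2), f.continuous.comp continuous_smul⟩
    change Continuous fun p : G × probMeasures X => (p.2 : WeakDual ℝ C(X, ℝ)) (F p.1)
    refine continuous_iff_continuousAt.mpr fun p₀ => ?_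
    have h1 : Continuous fun p : G × probMeasures X =>
        (p.2 : WeakDual ℝ C(X, ℝ)) (F p₀.1) :=
      (WeakDual.eval_continuous (F p₀.1)).comp (continuous_subtype_val.comp continuous_snd)
    have h2 : Filter.Tendsto (fun p : G × probMeasures X => ‖F p.1 - F p₀.1‖) (nhds p₀)
        (nhds 0) := by
      have h : Continuous fun p : G × probMeasures X => ‖F p.1 - F p₀.1‖ :=
        ((F.continuous.comp continuous_fst).sub continuous_const).norm
      simpa using h.tendsto p₀
    have h3 : Filter.Tendsto (fun p : G × probMeasures X =>
        (p.2 : WeakDual ℝ C(X, ℝ)) (F p.1 - F p₀.1)) (nhds p₀) (nhds 0) :=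
      squeeze_zero_norm (fun p => norm_apply_le_of_mem_probMeasures p.2.2 _) h2
    have h4 := h3.add (h1.tendsto p₀)
    rw [zero_add] at h4
    refine h4.congr fun p => ?_
    rw [map_sub, sub_add_cancel]
  affine_action := fun g x y z a b _ _ _ h => by
    change pushFunctional (X.translate g) (z : WeakDual ℝ C(X, ℝ)) = _
    rw [h]
    rfl

/-- The point of `P(X)` given by the Dirac mass at `x`. -/
noncomputable def dirac (X : GFlow G) (x : X) : X.prob :=
  ⟨diracFunctional x, diracFunctional_mem x⟩

end GFlow

/-! Every `G`-map from `X` to an affine flow extends uniquely to an affine `G`-map on `P(X)`,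
sending a measure to the barycenter of its image. A projective cover of `W` lifts along every
extension of `W`; by base change, its composite `q : X → K` with a `G`-map `W → K` lifts along
every extension of `K`.

Rigidity: if `f` and `g` are maps over `K` from one irreducible extension to another, so is their
midpoint, which is therefore surjective. Over an extreme point of the target the midpoint is
extreme, hence `f` and `g` agree there; by Krein–Milman `f` maps `{f = g}` onto the target, and
irreducibility of the source gives `f = g`. In particular affine projective covers are unique.

For projectivity of a minimal `L ⊆ P(X)`, let `π : P → Q` be an affine extension and `θ : L → Q`.
The fibre product `R` of `θ` and `π` is an extension of `K` through `L`, so `q` lifts to `X → R`.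
Extending its two components to `P(X) → L` and `P(X) → P` and restricting both to `L`, the first
becomes the identity by rigidity, so the second is the required lift of `θ`. -/

section Minimal

variable {X Y : Type*} {f : X → Y} {Q : Set X → Prop}

theorem image_sInter_eq_univ_of_isChain [TopologicalSpace X] [CompactSpace X]
    [TopologicalSpace Y] [T1Space Y] (hf : Continuous f) {c : Set (Set X)}
    (hchain : IsChain (· ⊆ ·) c) (hne : c.Nonempty) (hclosed : ∀ C ∈ c, IsClosed C)
    (himage : ∀ C ∈ c, f '' C = univ) : f '' ⋂₀ c = univ := by
  refine eq_univ_of_forall fun y => ?_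
  have : Nonempty c := hne.to_subtype
  have hclosed' : ∀ C : c, IsClosed ((C : Set X) ∩ f ⁻¹' {y}) := fun C =>
    (hclosed C C.2).inter (isClosed_singleton.preimage hf)
  have hdirected : Directed (· ⊇ ·) fun C : c => (C : Set X) ∩ f ⁻¹' {y} :=
    fun C D => (hchain.total C.2 D.2).elim
      (fun h => ⟨C, Subset.rfl, inter_subset_inter_left _ h⟩)
      fun h => ⟨D, inter_subset_inter_left _ h, Subset.rfl⟩
  have hfibre : ∀ C : c, ((C : Set X) ∩ f ⁻¹' {y}).Nonempty := fun C =>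
    let ⟨x, hx, hxy⟩ := (himage C C.2).ge (mem_univ y)
    ⟨x, hx, hxy⟩
  obtain ⟨x, hx⟩ := IsCompact.nonempty_iInter_of_directed_nonempty_isCompact_isClosed _
    hdirected hfibre (fun C => (hclosed' C).isCompact) hclosed'
  rw [mem_iInter] at hx
  exact ⟨x, mem_sInter.2 fun C hC => (hx ⟨C, hC⟩).1, (hx ⟨_, hne.some_mem⟩).2⟩

theorem exists_minimal_image_eq_univ [TopologicalSpace X] [CompactSpace X]
    [TopologicalSpace Y] [T1Space Y] [Nonempty Y] (hf : Continuous f)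
    (hsurj : Function.Surjective f) (huniv : Q univ) (hclosed : ∀ C, Q C → IsClosed C)
    (hsInter : ∀ c : Set (Set X), (∀ C ∈ c, Q C) → (⋂₀ c).Nonempty → Q (⋂₀ c)) :
    ∃ C, Minimal (fun C => Q C ∧ f '' C = univ) C := by
  have hsInter_mem : ∀ c ⊆ {C | Q C ∧ f '' C = univ}, IsChain (· ⊆ ·) c → c.Nonempty →
      Q (⋂₀ c) ∧ f '' ⋂₀ c = univ := fun c hc hchain hne => by
    have himage := image_sInter_eq_univ_of_isChain hf hchain hne
      (fun C hC => hclosed C (hc hC).1) fun C hC => (hc hC).2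
    have hne' : (⋂₀ c).Nonempty := .of_image (f := f) (himage ▸ univ_nonempty)
    exact ⟨hsInter c (fun C hC => (hc hC).1) hne', himage⟩
  obtain ⟨C, -, hC⟩ := zorn_superset_nonempty {C | Q C ∧ f '' C = univ}
    (fun c hc hchain hne => ⟨⋂₀ c, hsInter_mem c hc hchain hne, fun _ => sInter_subset_of_mem⟩)
    univ ⟨huniv, image_univ_of_surjective hsurj⟩
  exact ⟨C, hC⟩

theorem eq_univ_of_minimal_range {Z : Type*} {ι : Z → X} (hι : Function.Injective ι)
    (hmin : Minimal (fun C => Q C ∧ f '' C = univ) (range ι)) {D : Set Z} (hD : Q (ι '' D))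
    (himage : f ∘ ι '' D = univ) : D = univ := by
  rw [image_comp] at himage
  have heq : ι '' D = ι '' univ :=
    image_univ ▸ hmin.eq_of_subset ⟨hD, himage⟩ (image_subset_range ι D)
  exact hι.image_injective heq

end Minimal

theorem continuous_of_isClosed_graph {X Y : Type*} [TopologicalSpace X] [TopologicalSpace Y]
    [CompactSpace Y] {f : X → Y} (hf : IsClosed {p : X × Y | p.2 = f p.1}) : Continuous f := by
  refine continuous_iff_isClosed.2 fun C hC => ?_
  have hpre : f ⁻¹' C = Prod.fst '' ({p : X × Y | p.2 = f p.1} ∩ Prod.snd ⁻¹' C) := by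
    ext x
    simp
  rw [hpre]
  exact isClosedMap_fst_of_compactSpace _ (hf.inter (hC.preimage continuous_snd))

section ConvexCombinations

variable {E F H : Type*} [AddCommMonoid E] [Module ℝ E] [AddCommMonoid F] [Module ℝ F]
  [AddCommMonoid H] [Module ℝ H] {s : Set E} {t : Set F} {u : Set H}

/-- Compatibility of a map between subsets of real vector spaces with those two-term convex
combinations that lie in its domain. This is the affinity clause of `AffineFlow.IsAffineGMap`,
available without a group action. -/
def PreservesConvexCombinations (φ : s → t) : Prop :=
  ∀ (x y z : s) (a b : ℝ), 0 ≤ a → 0 ≤ b → a + b = 1 → (z : E) = a • (x : E) + b • (y : E) →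
    (φ z : F) = a • (φ x : F) + b • (φ y : F)

theorem PreservesConvexCombinations.comp {g : t → u} {f : s → t}
    (hg : PreservesConvexCombinations g) (hf : PreservesConvexCombinations f) :
    PreservesConvexCombinations (g ∘ f) :=
  fun x y z a b ha hb hab hz => hg _ _ _ a b ha hb hab (hf x y z a b ha hb hab hz)

theorem convex_image_val_iff (hs : Convex ℝ s) {C : Set s} :
    Convex ℝ (Subtype.val '' C) ↔ ∀ x ∈ C, ∀ y ∈ C, ∀ (z : s) (a b : ℝ), 0 ≤ a → 0 ≤ b →
      a + b = 1 → (z : E) = a • (x : E) + b • (y : E) → z ∈ C := by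
  constructor
  · intro hC x hx y hy z a b ha hb hab hz
    obtain ⟨w, hw, hwz⟩ := hC (mem_image_of_mem _ hx) (mem_image_of_mem _ hy) ha hb hab
    exact Subtype.ext (hwz.trans hz.symm) ▸ hw
  · rintro hC _ ⟨x, hx, rfl⟩ _ ⟨y, hy, rfl⟩ a b ha hb hab
    exact ⟨⟨_, hs x.2 y.2 ha hb hab⟩, hC x hx y hy _ a b ha hb hab rfl, rfl⟩

theorem PreservesConvexCombinations.convex_image {φ : s → t} (hφ : PreservesConvexCombinations φ)
    (hs : Convex ℝ s) {C : Set s} (hC : Convex ℝ (Subtype.val '' C)) :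
    Convex ℝ (Subtype.val '' (φ '' C)) := by
  rintro _ ⟨_, ⟨x, hx, rfl⟩, rfl⟩ _ ⟨_, ⟨y, hy, rfl⟩, rfl⟩ a b ha hb hab
  let z : s := ⟨a • (x : E) + b • (y : E), hs x.2 y.2 ha hb hab⟩
  exact ⟨φ z, ⟨z, (convex_image_val_iff hs).1 hC x hx y hy z a b ha hb hab rfl, rfl⟩,
    hφ x y z a b ha hb hab rfl⟩

theorem PreservesConvexCombinations.convex_eqLocus {φ ψ : s → t}
    (hφ : PreservesConvexCombinations φ) (hψ : PreservesConvexCombinations ψ) (hs : Convex ℝ s) :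
    Convex ℝ (Subtype.val '' {x | φ x = ψ x}) := by
  refine (convex_image_val_iff hs).2 fun x hx y hy z a b ha hb hab hz => Subtype.ext ?_
  rw [hφ x y z a b ha hb hab hz, hψ x y z a b ha hb hab hz, hx, hy]

end ConvexCombinations

section Barycenter

variable {X : Type u} [TopologicalSpace X]

theorem closedConvexHull_range_diracFunctional [CompactSpace X] [T2Space X] :
    closedConvexHull ℝ (range (diracFunctional (X := X))) = probMeasures X := by
  refine (closedConvexHull_min (range_subset_iff.2 diracFunctional_mem) convex_probMeasures
    isCompact_probMeasures.isClosed).antisymm fun Λ hΛ => ?_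
  have : LocallyConvexSpace ℝ (WeakDual ℝ C(X, ℝ)) :=
    inferInstanceAs (LocallyConvexSpace ℝ (WeakBilin (topDualPairing ℝ C(X, ℝ))))
  by_contra hmem
  obtain ⟨ℓ, u, hlt, hgt⟩ := geometric_hahn_banach_closed_point
    (convex_closedConvexHull (𝕜 := ℝ)) isClosed_closedConvexHull hmem
  -- weak-* continuous functionals are evaluations, so `ℓ` separates `Λ` from the Dirac masses
  -- through a function `f` with `f < u` pointwise but `u < Λ f`
  obtain ⟨f, rfl⟩ := LinearMap.dualEmbedding_surjective (topDualPairing ℝ C(X, ℝ)) ℓ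
  have hf : ∀ x, f x < u := fun x => hlt _ (subset_closedConvexHull ⟨x, rfl⟩)
  obtain ⟨hpos, hone⟩ := (mem_probMeasures_iff Λ).1 hΛ
  have hle := hpos (u • 1 - f) fun x => by simpa using! (hf x).le
  rw [map_sub, map_smul, hone, smul_eq_mul, mul_one] at hle
  exact (sub_nonneg.1 hle).not_gt hgt

theorem eq_of_forall_diracFunctional [CompactSpace X] [T2Space X] {F : Type*} [AddCommMonoid F]
    [Module ℝ F] [TopologicalSpace F] [T2Space F] {t : Set F} {φ ψ : probMeasures X → t}
    (hφ : Continuous φ) (hφ' : PreservesConvexCombinations φ) (hψ : Continuous ψ)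
    (hψ' : PreservesConvexCombinations ψ)
    (h : ∀ x, φ ⟨diracFunctional x, diracFunctional_mem x⟩ =
      ψ ⟨diracFunctional x, diracFunctional_mem x⟩) : φ = ψ := by
  have hdirac : range diracFunctional ⊆ Subtype.val '' {Λ | φ Λ = ψ Λ} :=
    range_subset_iff.2 fun x => ⟨_, h x, rfl⟩
  have hclosed : IsClosed (Subtype.val '' {Λ | φ Λ = ψ Λ}) :=
    isCompact_probMeasures.isClosed.isClosedMap_subtype_val _ (isClosed_eq hφ hψ)
  have hle : probMeasures X ⊆ Subtype.val '' {Λ | φ Λ = ψ Λ} :=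
    closedConvexHull_range_diracFunctional.ge.trans
      (closedConvexHull_min hdirac (hφ'.convex_eqLocus hψ' convex_probMeasures) hclosed)
  funext Λ
  obtain ⟨Λ', hΛ', heq⟩ := hle Λ.2
  rwa [← Subtype.ext heq]

variable {E : Type*} [AddCommGroup E] [Module ℝ E] [TopologicalSpace E]

/-- The vector `k` is the barycenter of the push-forward under `α` of the functional `Λ`, in the
weak sense that every continuous linear functional on `E` takes its `Λ`-average at `k`. -/
def IsBarycenter (α : C(X, E)) (Λ : WeakDual ℝ C(X, ℝ)) (k : E) : Prop :=
  ∀ ℓ : StrongDual ℝ E, ℓ k = Λ ((ℓ : C(E, ℝ)).comp α)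

variable {α : C(X, E)} {s : Set E}

theorem isBarycenter_diracFunctional (α : C(X, E)) (x : X) :
    IsBarycenter α (diracFunctional x) (α x) :=
  fun _ => rfl

theorem IsBarycenter.unique [SeparatingDual ℝ E] {Λ : WeakDual ℝ C(X, ℝ)} {k k' : E}
    (h : IsBarycenter α Λ k) (h' : IsBarycenter α Λ k') : k = k' := by
  by_contra hne
  obtain ⟨ℓ, hℓ⟩ := SeparatingDual.exists_separating_of_ne (R := ℝ) hne
  exact hℓ ((h ℓ).trans (h' ℓ).symm)

theorem IsBarycenter.smul_add_smul {Λ Λ' : WeakDual ℝ C(X, ℝ)} {k k' : E}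
    (h : IsBarycenter α Λ k) (h' : IsBarycenter α Λ' k') (a b : ℝ) :
    IsBarycenter α (a • Λ + b • Λ') (a • k + b • k') := by
  intro ℓ
  rw [map_add, map_smul, map_smul, h ℓ, h' ℓ]
  rfl

theorem isClosed_setOf_isBarycenter (α : C(X, E)) :
    IsClosed {q : WeakDual ℝ C(X, ℝ) × E | IsBarycenter α q.1 q.2} := by
  simp only [IsBarycenter, ofPred_forall]
  exact isClosed_iInter fun ℓ => isClosed_eq (ℓ.continuous.comp continuous_snd)
    ((WeakDual.eval_continuous _).comp continuous_fst)

theorem exists_isBarycenter [CompactSpace X] [T2Space X] [T2Space E] (hα : ∀ x, α x ∈ s)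
    (hs : IsCompact s) (hconv : Convex ℝ s) {Λ : WeakDual ℝ C(X, ℝ)} (hΛ : Λ ∈ probMeasures X) :
    ∃ k ∈ s, IsBarycenter α Λ k := by
  let graph := {q : WeakDual ℝ C(X, ℝ) × E | IsBarycenter α q.1 q.2} ∩ probMeasures X ×ˢ s
  have hcompact : IsCompact graph :=
    (isCompact_probMeasures.prod hs).inter_left (isClosed_setOf_isBarycenter α)
  have hconvex : Convex ℝ graph :=
    Convex.inter (fun _ h _ h' a b _ _ _ => h.smul_add_smul h' a b)
      (convex_probMeasures.prod hconv)
  have hdirac : range diracFunctional ⊆ Prod.fst '' graph := range_subset_iff.2 fun x =>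
    ⟨(diracFunctional x, α x),
      ⟨isBarycenter_diracFunctional α x, diracFunctional_mem x, hα x⟩, rfl⟩
  rw [← closedConvexHull_range_diracFunctional] at hΛ
  obtain ⟨⟨_, k⟩, ⟨hk, -, hks⟩, rfl⟩ := closedConvexHull_min hdirac
    (hconvex.linear_image (LinearMap.fst ℝ _ E)) (hcompact.image continuous_fst).isClosed hΛ
  exact ⟨k, hks, hk⟩

theorem exists_extension_probMeasures [CompactSpace X] [T2Space X] [T2Space E] [SeparatingDual ℝ E]
    (hs : IsCompact s) (hconv : Convex ℝ s) {α : X → s} (hα : Continuous α) :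
    ∃ β : probMeasures X → s, Continuous β ∧ PreservesConvexCombinations β ∧
      ∀ x, β ⟨diracFunctional x, diracFunctional_mem x⟩ = α x := by
  let α' : C(X, E) := ⟨fun x => α x, continuous_subtype_val.comp hα⟩
  have hbary (Λ : probMeasures X) : ∃ k : s, IsBarycenter α' Λ k :=
    let ⟨k, hks, hk⟩ := exists_isBarycenter (fun x => (α x).2) hs hconv Λ.2
    ⟨⟨k, hks⟩, hk⟩
  choose β hβ using hbary
  have hβ_eq {Λ : probMeasures X} {k : s} (hk : IsBarycenter α' Λ k) : k = β Λ :=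
    Subtype.ext (hk.unique (hβ Λ))
  refine ⟨β, ?_, fun Λ Λ' Λ'' a b _ _ _ hΛ => ?_,
    fun x => (hβ_eq (isBarycenter_diracFunctional α' x)).symm⟩
  · have := isCompact_iff_compactSpace.1 hs
    have hgraph : {p : probMeasures X × s | p.2 = β p.1} = {p | IsBarycenter α' p.1 p.2} :=
      Set.ext fun p =>
        ⟨fun (hp : p.2 = β p.1) => show IsBarycenter α' p.1 p.2 from hp ▸ hβ p.1, hβ_eq⟩
    refine continuous_of_isClosed_graph (hgraph ▸ ?_)
    exact (isClosed_setOf_isBarycenter α').preimage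
      (continuous_subtype_val.prodMap continuous_subtype_val)
  · exact (hβ Λ'').unique (hΛ ▸ (hβ Λ).smul_add_smul (hβ Λ') a b)

end Barycenter

namespace GFlow

variable {G : Type u} [Group G] [TopologicalSpace G] {X Y Z W : GFlow G}

theorem IsGMap.comp {g : Y → Z} {f : X → Y} (hg : IsGMap g) (hf : IsGMap f) : IsGMap (g ∘ f) :=
  ⟨hg.1.comp hf.1, fun a x => by simp only [Function.comp_apply, hf.2, hg.2]⟩

theorem isSubflow_univ (X : GFlow G) : X.IsSubflow univ :=
  ⟨univ_nonempty, isClosed_univ, fun _ _ _ => mem_univ _⟩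

theorem IsSubflow.image {f : X → Y} (hf : IsGMap f) {C : Set X} (hC : X.IsSubflow C) :
    Y.IsSubflow (f '' C) := by
  refine ⟨hC.1.image f, (hC.2.1.isCompact.image hf.1).isClosed, ?_⟩
  rintro g _ ⟨x, hx, rfl⟩
  exact ⟨g • x, hC.2.2 g x hx, hf.2 g x⟩

theorem IsSubflow.sInter {c : Set (Set X)} (hc : ∀ C ∈ c, X.IsSubflow C) (hne : (⋂₀ c).Nonempty) :
    X.IsSubflow (⋂₀ c) :=
  ⟨hne, isClosed_sInter fun C hC => (hc C hC).2.1,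
    fun g x hx => mem_sInter.2 fun C hC => (hc C hC).2.2 g x (hx C hC)⟩

theorem isSubflow_eqLocus {f g : X → Y} (hf : IsGMap f) (hg : IsGMap g)
    (hne : {x | f x = g x}.Nonempty) : X.IsSubflow {x | f x = g x} :=
  ⟨hne, isClosed_eq hf.1 hg.1, fun a x (hx : f x = g x) =>
    show f (a • x) = g (a • x) by rw [hf.2, hg.2, hx]⟩

/-- The inclusion of a subflow, as a map between flows. -/
def restrictIncl (X : GFlow G) (C : Set X) (hC : X.IsSubflow C) (x : X.restrict C hC) : X :=
  Subtype.val (p := fun y : X => y ∈ C) x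

theorem isGMap_restrictIncl {C : Set X} (hC : X.IsSubflow C) : IsGMap (X.restrictIncl C hC) :=
  ⟨continuous_subtype_val, fun _ _ => rfl⟩

theorem restrictIncl_injective {C : Set X} (hC : X.IsSubflow C) :
    Function.Injective (X.restrictIncl C hC) :=
  Subtype.val_injective

theorem range_restrictIncl {C : Set X} (hC : X.IsSubflow C) : range (X.restrictIncl C hC) = C :=
  Subtype.range_val

theorem IsExtension.exists_isGIrreducible_restrict {π : Z → W} (hπ : IsExtension π) :
    ∃ (C : Set Z) (hC : Z.IsSubflow C), IsGIrreducible (π ∘ Z.restrictIncl C hC) := by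
  obtain ⟨C, hmin⟩ := exists_minimal_image_eq_univ hπ.1.1 hπ.2 Z.isSubflow_univ
    (fun _ hC => hC.2.1) fun _ => IsSubflow.sInter
  obtain ⟨hC, himage⟩ := hmin.prop
  have hincl := isGMap_restrictIncl hC
  refine ⟨C, hC, ⟨hπ.1.comp hincl, ?_⟩, fun D hD hne h => hne ?_⟩
  · rw [← range_eq_univ, range_comp, range_restrictIncl, himage]
  · exact eq_univ_of_minimal_range (restrictIncl_injective hC)
      ((range_restrictIncl hC).symm ▸ hmin) (hD.image hincl) h

/-- The map `p` factors, through a `G`-map, over every extension of its codomain. This is the form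
in which the universal property of a projective cover is used: unlike that property, it survives
composition of `p` with a `G`-map to another flow. -/
def LiftsAlongExtensions (p : X → W) : Prop :=
  ∀ ⦃Z : GFlow G⦄ ⦃π : Z → W⦄, IsExtension π → ∃ ψ : X → Z, IsGMap ψ ∧ π ∘ ψ = p

theorem LiftsAlongExtensions.isGMap {p : X → W} (hp : LiftsAlongExtensions p) : IsGMap p := by
  obtain ⟨ψ, hψ, rfl⟩ := hp (π := id) ⟨⟨continuous_id, fun _ _ => rfl⟩, Function.surjective_id⟩
  exact hψ

theorem IsGProjectiveCover.liftsAlongExtensions {p : X → W} (hp : IsGProjectiveCover p) :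
    LiftsAlongExtensions p := by
  intro Z π hπ
  obtain ⟨C, hC, hirr⟩ := hπ.exists_isGIrreducible_restrict
  obtain ⟨ψ, hψ, h⟩ := hp.2 _ _ hirr
  exact ⟨Z.restrictIncl C hC ∘ ψ, (isGMap_restrictIncl hC).comp hψ, h⟩

/-- The product of two flows, with the diagonal action; fibre products are subflows of it. -/
def prod (X Y : GFlow G) : GFlow G where
  carrier := X × Y

theorem isGMap_prod_fst (X Y : GFlow G) : IsGMap (X := X.prod Y) (Y := X) Prod.fst :=
  ⟨continuous_fst, fun _ _ => rfl⟩

theorem isGMap_prod_snd (X Y : GFlow G) : IsGMap (X := X.prod Y) (Y := Y) Prod.snd :=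
  ⟨continuous_snd, fun _ _ => rfl⟩

theorem IsExtension.exists_baseChange {π : Z → W} (hπ : IsExtension π) {f : X → W}
    (hf : IsGMap f) :
    ∃ (R : GFlow G) (r₁ : R → X) (r₂ : R → Z),
      IsExtension r₁ ∧ IsGMap r₂ ∧ f ∘ r₁ = π ∘ r₂ := by
  let fst : X.prod Z → X := Prod.fst
  let snd : X.prod Z → Z := Prod.snd
  have hfst : IsGMap fst := isGMap_prod_fst X Z
  have hsnd : IsGMap snd := isGMap_prod_snd X Z
  have hlift (x : X) : ∃ t : X.prod Z, (f ∘ fst) t = (π ∘ snd) t ∧ fst t = x :=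
    let ⟨z, hz⟩ := hπ.2 (f x)
    ⟨(x, z), hz.symm, rfl⟩
  have hsub : (X.prod Z).IsSubflow {t | (f ∘ fst) t = (π ∘ snd) t} :=
    isSubflow_eqLocus (hf.comp hfst) (hπ.1.comp hsnd)
      ((hlift (Classical.arbitrary X)).imp fun _ => And.left)
  have hincl := isGMap_restrictIncl hsub
  refine ⟨_, fst ∘ (X.prod Z).restrictIncl _ hsub, snd ∘ (X.prod Z).restrictIncl _ hsub,
    ⟨hfst.comp hincl, fun x => ?_⟩, hsnd.comp hincl, funext fun t => ?_⟩
  · obtain ⟨t, ht, rfl⟩ := hlift x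
    exact ⟨⟨t, ht⟩, rfl⟩
  · exact Subtype.prop (p := fun t : X.prod Z => (f ∘ fst) t = (π ∘ snd) t) t

theorem LiftsAlongExtensions.comp_left {p : X → W} (hp : LiftsAlongExtensions p) {j : W → Y}
    (hj : IsGMap j) : LiftsAlongExtensions (j ∘ p) := by
  intro Z π hπ
  obtain ⟨R, r₁, r₂, hr₁, hr₂, hcomm⟩ := hπ.exists_baseChange hj
  obtain ⟨ψ, hψ, rfl⟩ := hp hr₁
  exact ⟨r₂ ∘ ψ, hr₂.comp hψ, by rw [← Function.comp_assoc, ← hcomm, Function.comp_assoc]⟩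

end GFlow

namespace AffineFlow

variable {G : Type u} [Group G] [TopologicalSpace G] {K L M : AffineFlow G}

instance (K : AffineFlow G) : CompactSpace K := K.toGFlow.compact

instance (K : AffineFlow G) : Nonempty K := K.toGFlow.nonempty

theorem IsAffineGMap.isGMap {f : K → L} (hf : IsAffineGMap f) :
    GFlow.IsGMap (X := K.toGFlow) (Y := L.toGFlow) f :=
  ⟨hf.1, hf.2.1⟩

theorem IsAffineGMap.preservesConvexCombinations {f : K → L} (hf : IsAffineGMap f) :
    PreservesConvexCombinations f :=
  hf.2.2

theorem IsAffineGMap.comp {g : L → M} {f : K → L} (hg : IsAffineGMap g) (hf : IsAffineGMap f) :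
    IsAffineGMap (g ∘ f) :=
  ⟨hg.1.comp hf.1, (hg.isGMap.comp hf.isGMap).2,
    hg.preservesConvexCombinations.comp hf.preservesConvexCombinations⟩

theorem isAffineGMap_id (K : AffineFlow G) : IsAffineGMap (id : K → K) :=
  ⟨continuous_id, fun _ _ => rfl, fun _ _ _ _ _ _ _ _ h => h⟩

theorem preservesConvexCombinations_smul (K : AffineFlow G) (g : G) :
    PreservesConvexCombinations fun x : K => g • x :=
  K.affine_action g

theorem isAffineSubflow_univ (K : AffineFlow G) : K.IsAffineSubflow univ :=
  ⟨univ_nonempty, isClosed_univ,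
    (convex_image_val_iff K.convex).2 fun _ _ _ _ _ _ _ _ _ _ _ => mem_univ _,
    fun _ _ _ => mem_univ _⟩

theorem IsAffineSubflow.image {f : K → L} (hf : IsAffineGMap f) {C : Set K}
    (hC : K.IsAffineSubflow C) : L.IsAffineSubflow (f '' C) := by
  have himage : L.toGFlow.IsSubflow (f '' C) :=
    GFlow.IsSubflow.image hf.isGMap ⟨hC.1, hC.2.1, hC.2.2.2⟩
  exact ⟨himage.1, himage.2.1, hf.preservesConvexCombinations.convex_image K.convex hC.2.2.1,
    himage.2.2⟩

theorem IsAffineSubflow.sInter {c : Set (Set K)} (hc : ∀ C ∈ c, K.IsAffineSubflow C)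
    (hne : (⋂₀ c).Nonempty) : K.IsAffineSubflow (⋂₀ c) := by
  have hconvex : Convex ℝ (Subtype.val '' ⋂₀ c : Set K.E) :=
    (convex_image_val_iff K.convex).2 fun x hx y hy z a b ha hb hab hz C hC =>
      (convex_image_val_iff K.convex).1 (hc C hC).2.2.1 x (hx C hC) y (hy C hC) z a b ha hb hab hz
  exact ⟨hne, isClosed_sInter fun C hC => (hc C hC).2.1, hconvex,
    fun g x hx C hC => (hc C hC).2.2.2 g x (hx C hC)⟩

theorem isAffineSubflow_eqLocus {f g : K → L} (hf : IsAffineGMap f) (hg : IsAffineGMap g)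
    (hne : {x | f x = g x}.Nonempty) : K.IsAffineSubflow {x | f x = g x} := by
  have hsub : K.toGFlow.IsSubflow {x | f x = g x} :=
    GFlow.isSubflow_eqLocus hf.isGMap hg.isGMap hne
  exact ⟨hne, hsub.2.1,
    hf.preservesConvexCombinations.convex_eqLocus hg.preservesConvexCombinations K.convex,
    hsub.2.2⟩

theorem isAffineGMap_incl {C : Set K} (hC : K.IsAffineSubflow C) : IsAffineGMap (K.incl C hC) :=
  ⟨Continuous.subtype_mk continuous_subtype_val _, fun _ _ => rfl, fun _ _ _ _ _ _ _ _ h => h⟩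

theorem incl_injective {C : Set K} (hC : K.IsAffineSubflow C) :
    Function.Injective (K.incl C hC) :=
  fun _ _ h => Subtype.ext (congrArg (fun z : K => (z : K.E)) h)

theorem range_incl {C : Set K} (hC : K.IsAffineSubflow C) : range (K.incl C hC) = C :=
  (range_subset_iff.2 fun x => K.ofImage_mem C x).antisymm
    fun x hx => ⟨⟨(x : K.E), mem_image_of_mem _ hx⟩, rfl⟩

theorem isGMap_extIncl (K : AffineFlow G) : GFlow.IsGMap (Y := K.toGFlow) K.extIncl :=
  GFlow.isGMap_restrictIncl K.isSubflow_closure_extPts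

theorem extPts_subset_range_extIncl (K : AffineFlow G) : K.extPts ⊆ range K.extIncl :=
  subset_closure.trans (GFlow.range_restrictIncl K.isSubflow_closure_extPts).ge

theorem eq_univ_of_extPts_subset {C : Set K} (hclosed : IsClosed C)
    (hconv : Convex ℝ (Subtype.val '' C : Set K.E)) (hext : K.extPts ⊆ C) : C = univ := by
  have hle : K.carrier ⊆ Subtype.val '' C := by
    refine (closure_convexHull_extremePoints K.compact K.convex).ge.trans ?_
    exact closure_minimal (convexHull_min (fun x hx => ⟨⟨x, hx.1⟩, hext hx, rfl⟩) hconv)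
      (hclosed.isCompact.image continuous_subtype_val).isClosed
  refine eq_univ_of_forall fun x => ?_
  obtain ⟨y, hy, hyx⟩ := hle x.2
  exact Subtype.ext hyx ▸ hy

theorem surjective_of_extPts_subset_range {φ : K → L} (hφ : IsAffineGMap φ)
    (hext : L.extPts ⊆ range φ) : Function.Surjective φ := by
  have himage : L.IsAffineSubflow (range φ) := image_univ ▸ K.isAffineSubflow_univ.image hφ
  exact range_eq_univ.1 (eq_univ_of_extPts_subset himage.2.1 himage.2.2.1 hext)

/-- The midpoint of two points of an affine flow, as a point of the flow. Two affine `G`-maps into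
the flow are compared through their pointwise midpoint. -/
noncomputable def mid (K : AffineFlow G) (x y : K) : K :=
  ⟨midpoint ℝ (x : K.E) y, K.convex.midpoint_mem x.2 y.2⟩

theorem coe_mid (x y : K) :
    (K.mid x y : K.E) = (2⁻¹ : ℝ) • (x : K.E) + (2⁻¹ : ℝ) • (y : K.E) := by
  rw [← smul_add, ← invOf_eq_inv]
  exact midpoint_eq_smul_add ℝ _ _

theorem mid_self (x : K) : K.mid x x = x :=
  Subtype.ext (midpoint_self ℝ (x : K.E))

theorem map_mid {φ : K → L} (hφ : PreservesConvexCombinations φ) (x y : K) :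
    φ (K.mid x y) = L.mid (φ x) (φ y) := by
  refine Subtype.ext ?_
  rw [coe_mid]
  exact hφ x y _ _ _ (by norm_num) (by norm_num) (by norm_num) (coe_mid x y)

theorem IsAffineGMap.mid {f g : K → L} (hf : IsAffineGMap f) (hg : IsAffineGMap g) :
    IsAffineGMap fun x => L.mid (f x) (g x) := by
  refine ⟨Continuous.subtype_mk ?_ _, fun a x => ?_, fun x y z a b ha hb hab hz => ?_⟩
  · simp only [midpoint_eq_smul_add]
    exact ((continuous_subtype_val.comp hf.1).add (continuous_subtype_val.comp hg.1)).const_smul _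
  · exact (congrArg₂ L.mid (hf.2.1 a x) (hg.2.1 a x)).trans
      (map_mid (L.preservesConvexCombinations_smul a) _ _).symm
  · simp only [coe_mid]
    rw [hf.2.2 x y z a b ha hb hab hz, hg.2.2 x y z a b ha hb hab hz]
    module

theorem eq_of_mid_mem_extPts {x y : K} (h : K.mid x y ∈ K.extPts) :
    x = K.mid x y ∧ y = K.mid x y := by
  have hmem : (K.mid x y : K.E) ∈ openSegment ℝ (x : K.E) y :=
    ⟨2⁻¹, 2⁻¹, by norm_num, by norm_num, by norm_num, (coe_mid x y).symm⟩
  obtain ⟨hx, hy⟩ := (mem_extremePoints.1 h).2 _ x.2 _ y.2 hmem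
  exact ⟨Subtype.ext hx, Subtype.ext hy⟩

theorem IsAffineGIrreducible.eq_univ {φ : K → L} (hφ : IsAffineGIrreducible φ) {C : Set K}
    (hC : K.IsAffineSubflow C) (himage : φ '' C = univ) : C = univ :=
  not_not.1 fun hne => hφ.2 C hC hne himage

theorem IsAffineGIrreducible.surjective_of_comp {φ : K → L} (hφ : IsAffineGIrreducible φ)
    {h : M → K} (hh : IsAffineGMap h) (hsurj : Function.Surjective (φ ∘ h)) :
    Function.Surjective h := by
  refine range_eq_univ.1 (hφ.eq_univ (image_univ ▸ M.isAffineSubflow_univ.image hh) ?_)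
  rw [← range_comp, hsurj.range_eq]

theorem extPts_subset_image_eqLocus {f g : M → L}
    (hsurj : Function.Surjective fun m => L.mid (f m) (g m)) :
    L.extPts ⊆ f '' {m | f m = g m} := by
  intro e he
  obtain ⟨m, rfl⟩ := hsurj e
  obtain ⟨hf, hg⟩ := eq_of_mid_mem_extPts he
  exact ⟨m, hf.trans hg.symm, hf⟩

theorem IsAffineGIrreducible.eq_of_comp_eq {ρ : M → K} {φ : L → K} (hρ : IsAffineGIrreducible ρ)
    (hφ : IsAffineGIrreducible φ) {f g : M → L} (hf : IsAffineGMap f) (hg : IsAffineGMap g)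
    (hfρ : φ ∘ f = ρ) (hgρ : φ ∘ g = ρ) : f = g := by
  have hmid : φ ∘ (fun m => L.mid (f m) (g m)) = ρ := by
    funext m
    rw [Function.comp_apply, map_mid hφ.1.1.preservesConvexCombinations]
    exact (congrArg₂ K.mid (congrFun hfρ m) (congrFun hgρ m)).trans (mid_self _)
  have hext : L.extPts ⊆ f '' {m | f m = g m} :=
    extPts_subset_image_eqLocus (hφ.surjective_of_comp (hf.mid hg) (hmid ▸ hρ.1.2))
  obtain ⟨e, he⟩ := L.compact.extremePoints_nonempty L.nonempty
  have hsub : M.IsAffineSubflow {m | f m = g m} :=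
    isAffineSubflow_eqLocus hf hg (.of_image ⟨_, hext (a := ⟨e, he.1⟩) he⟩)
  have himage : f '' {m | f m = g m} = univ :=
    eq_univ_of_extPts_subset (hsub.image hf).2.1 (hsub.image hf).2.2.1 hext
  have heq : {m | f m = g m} = univ := hρ.eq_univ hsub (by
    rw [← hfρ, image_comp, himage, image_univ_of_surjective hφ.1.2])
  exact funext fun m => heq.ge (mem_univ m)

theorem IsAffineExtension.exists_minimal {φ : K → L} (hφ : IsAffineExtension φ) :
    ∃ C : Set K, Minimal (fun C : Set K => K.IsAffineSubflow C ∧ φ '' C = univ) C :=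
  exists_minimal_image_eq_univ hφ.1.1 hφ.2 K.isAffineSubflow_univ (fun _ hC => hC.2.1)
    fun _ => IsAffineSubflow.sInter

theorem IsAffineGMap.isAffineGIrreducible_incl {φ : K → L} (hφ : IsAffineGMap φ) {C : Set K}
    (hC : K.IsAffineSubflow C)
    (hmin : Minimal (fun C : Set K => K.IsAffineSubflow C ∧ φ '' C = univ) C) :
    IsAffineGIrreducible (φ ∘ K.incl C hC) := by
  have hincl := isAffineGMap_incl hC
  refine ⟨⟨hφ.comp hincl, ?_⟩, fun D hD hne h => hne ?_⟩
  · rw [← range_eq_univ, range_comp, range_incl, hmin.prop.2]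
  · exact eq_univ_of_minimal_range (incl_injective hC) ((range_incl hC).symm ▸ hmin)
      (hD.image hincl) h

theorem IsAffineGProjectiveCover.exists_bijective {φ : L → K} {ψ : M → K}
    (hφ : IsAffineGProjectiveCover φ) (hψ : IsAffineGProjectiveCover ψ) :
    ∃ e : L → M, IsAffineGMap e ∧ Function.Bijective e ∧ ψ ∘ e = φ := by
  obtain ⟨e, he, heφ⟩ := hφ.1 _ _ φ ψ hφ.2.1.1 hψ.2.1
  obtain ⟨d, hd, hdψ⟩ := hψ.1 _ _ ψ φ hψ.2.1.1 hφ.2.1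
  have hde : d ∘ e = id := hφ.2.eq_of_comp_eq hφ.2 (hd.comp he) (isAffineGMap_id L)
    (by rw [← Function.comp_assoc, hdψ, heφ]) rfl
  have hed : e ∘ d = id := hψ.2.eq_of_comp_eq hψ.2 (he.comp hd) (isAffineGMap_id M)
    (by rw [← Function.comp_assoc, heφ, hdψ]) rfl
  exact ⟨e, he, Function.bijective_iff_has_inverse.2 ⟨d, congrFun hde, congrFun hed⟩, heφ⟩

end AffineFlow

namespace GFlow

variable {G : Type u} [Group G] [TopologicalSpace G] {X : GFlow G} {K : AffineFlow G}

theorem smul_dirac (g : G) (x : X) : g • X.dirac x = X.dirac (g • x) :=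
  rfl

theorem eq_of_forall_dirac {φ ψ : X.prob → K} (hφ : AffineFlow.IsAffineGMap φ)
    (hψ : AffineFlow.IsAffineGMap ψ) (h : ∀ x, φ (X.dirac x) = ψ (X.dirac x)) : φ = ψ :=
  eq_of_forall_diracFunctional hφ.1 hφ.preservesConvexCombinations hψ.1
    hψ.preservesConvexCombinations h

theorem IsGMap.exists_extend_prob {α : X → K.toGFlow} (hα : IsGMap α) :
    ∃ β : X.prob → K, AffineFlow.IsAffineGMap β ∧ ∀ x, β (X.dirac x) = α x := by
  obtain ⟨β, hβ, hβ', hdirac⟩ := exists_extension_probMeasures K.compact K.convex hα.1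
  replace hdirac : ∀ x, β (X.dirac x) = α x := hdirac
  have hsmul (g : G) : (fun Λ : X.prob => β (g • Λ)) = fun Λ => (g • β Λ : K) :=
    eq_of_forall_diracFunctional (hβ.comp (continuous_const_smul (T := X.prob) g))
      (hβ'.comp (X.prob.preservesConvexCombinations_smul g))
      ((continuous_const_smul (T := K) g).comp hβ)
      ((K.preservesConvexCombinations_smul g).comp hβ')
      fun x => show β (g • X.dirac x) = g • β (X.dirac x) by
        rw [smul_dirac, hdirac, hdirac]
        exact hα.2 g x
  exact ⟨β, ⟨hβ, fun g => congrFun (hsmul g), hβ'⟩, hdirac⟩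

theorem LiftsAlongExtensions.isAffineGProjective {q : X → K.toGFlow} (hq : LiftsAlongExtensions q)
    {φ : X.prob → K} (hφ : AffineFlow.IsAffineGMap φ) (hφq : ∀ x, φ (X.dirac x) = q x)
    {N : AffineFlow G} {ι : N → X.prob} (hι : AffineFlow.IsAffineGMap ι)
    (hirr : AffineFlow.IsAffineGIrreducible (φ ∘ ι)) : N.IsAffineGProjective := by
  intro Q P θ π hθ hπ
  obtain ⟨R, r₁, r₂, hr₁, hr₂, hcomm⟩ :=
    IsExtension.exists_baseChange (W := Q.toGFlow) ⟨hπ.1.isGMap, hπ.2⟩ hθ.isGMap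
  obtain ⟨ψ, hψ, hψq⟩ := hq (π := (φ ∘ ι) ∘ r₁)
    ⟨hirr.1.1.isGMap.comp hr₁.1, hirr.1.2.comp hr₁.2⟩
  obtain ⟨β₁, hβ₁, hβ₁ψ⟩ := IsGMap.exists_extend_prob (hr₁.1.comp hψ)
  obtain ⟨β₂, hβ₂, hβ₂ψ⟩ := IsGMap.exists_extend_prob (hr₂.comp hψ)
  have hφβ₁ : (φ ∘ ι) ∘ β₁ = φ := eq_of_forall_dirac (hirr.1.1.comp hβ₁) hφ fun x => by
    rw [hφq, ← hψq, Function.comp_apply, hβ₁ψ]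
    rfl
  have hπβ₂ : π ∘ β₂ = θ ∘ β₁ := eq_of_forall_dirac (hπ.1.comp hβ₂) (hθ.comp hβ₁) fun x => by
    rw [Function.comp_apply, Function.comp_apply, hβ₁ψ, hβ₂ψ]
    exact (congrFun hcomm (ψ x)).symm
  have hβ₁ι : β₁ ∘ ι = id := hirr.eq_of_comp_eq hirr (hβ₁.comp hι) (AffineFlow.isAffineGMap_id N)
    (by rw [← Function.comp_assoc, hφβ₁]) rfl
  exact ⟨β₂ ∘ ι, hβ₂.comp hι, by
    rw [← Function.comp_assoc, hπβ₂, Function.comp_assoc, hβ₁ι, Function.comp_id]⟩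

end GFlow

theorem mainTheorem12_general {G : Type u} [Group G] [TopologicalSpace G] (K : AffineFlow G)
    (X : GFlow G) (q : X → K.toGFlow) (hq : GFlow.LiftsAlongExtensions q)
    (hext : K.extPts ⊆ range q) :
    ∃ φ : X.prob → K, AffineFlow.IsAffineExtension φ ∧
      (∀ x : X, φ (X.dirac x) = q x) ∧
      (∃ L : Set X.prob,
        Minimal (fun C : Set X.prob => X.prob.IsAffineSubflow C ∧ φ '' C = Set.univ) L) ∧
      ∀ (L : Set X.prob) (hL : X.prob.IsAffineSubflow L),
        Minimal (fun C : Set X.prob => X.prob.IsAffineSubflow C ∧ φ '' C = Set.univ) L →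
        AffineFlow.IsAffineGProjectiveCover (φ ∘ X.prob.incl L hL) ∧
        ∀ (M : AffineFlow G) (ψ : M → K), AffineFlow.IsAffineGProjectiveCover ψ →
          ∃ e : X.prob.restrict L hL → M, AffineFlow.IsAffineGMap e ∧ Function.Bijective e ∧
            ψ ∘ e = φ ∘ X.prob.incl L hL := by
  obtain ⟨φ, hφ, hφq⟩ := hq.isGMap.exists_extend_prob
  have hrange : range q ⊆ range φ := range_subset_iff.2 fun x => ⟨X.dirac x, hφq x⟩
  have hφ_ext : AffineFlow.IsAffineExtension φ :=
    ⟨hφ, AffineFlow.surjective_of_extPts_subset_range hφ (hext.trans hrange)⟩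
  refine ⟨φ, hφ_ext, hφq, hφ_ext.exists_minimal, fun L hL hmin => ?_⟩
  have hirr := hφ.isAffineGIrreducible_incl hL hmin
  have hcover : AffineFlow.IsAffineGProjectiveCover (φ ∘ X.prob.incl L hL) :=
    ⟨hq.isAffineGProjective hφ hφq (AffineFlow.isAffineGMap_incl hL) hirr, hirr⟩
  exact ⟨hcover, fun M ψ hψ => hcover.exists_bijective hψ⟩

theorem mainTheorem12 {G : Type u} [Group G] [TopologicalSpace G] [IsTopologicalGroup G]
    (K : AffineFlow G) (X : GFlow G) (p : X → K.extClosure) (hp : GFlow.IsGProjectiveCover p) :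
    ∃ φ : X.prob → K, AffineFlow.IsAffineExtension φ ∧
      (∀ x : X, φ (X.dirac x) = K.extIncl (p x)) ∧
      (∃ L : Set X.prob,
        Minimal (fun C : Set X.prob => X.prob.IsAffineSubflow C ∧ φ '' C = Set.univ) L) ∧
      ∀ (L : Set X.prob) (hL : X.prob.IsAffineSubflow L),
        Minimal (fun C : Set X.prob => X.prob.IsAffineSubflow C ∧ φ '' C = Set.univ) L →
        AffineFlow.IsAffineGProjectiveCover (φ ∘ X.prob.incl L hL) ∧
        ∀ (M : AffineFlow G) (ψ : M → K), AffineFlow.IsAffineGProjectiveCover ψ →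
          ∃ e : X.prob.restrict L hL → M, AffineFlow.IsAffineGMap e ∧ Function.Bijective e ∧
            ψ ∘ e = φ ∘ X.prob.incl L hL :=
  mainTheorem12_general K X (K.extIncl ∘ p) (hp.liftsAlongExtensions.comp_left K.isGMap_extIncl)
    (K.extPts_subset_range_extIncl.trans_eq (hp.1.1.2.range_comp _).symm)
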